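/- Let $\mathsf F,\mathsf P,\mathsf C$ be real separable Hilbert spaces with their Borel $\sigma$-algebras, let $\mathcal P\in L(\mathsf F,\mathsf P)$ be a bounded linear operator, let $\{X(t)\}_{t\ge 0}$ be an $\mathsf F$-valued stochastic process on a probability space $(\Omega,\mathcal F,\mathbb P)$, and let $Y(t)=\mathcal PX(t)$. For a Borel probability measure $\mu$ on a real Hilbert space $\mathsf H$ whose characteristic function $\widehat\mu(u)=\int_{\mathsf H} e^{\mathrm i\langle u,x\rangle}\,\mu(dx)$ has no zeros, the cumulant function of $\mu$ is $\log\widehat\mu$, where $\log$ is the distinguished logarithm: the unique continuous $\Psi:\mathsf H\to\mathbb C$ with $\Psi(0)=0$ and $e^{\Psi}=\widehat\mu$. A cumulant function on $\mathsf H$ is the cumulant function of some such $\mu$. Assume that for each $t\ge0$ the characteristic function of $X(t)$ has no zeros, so that the cumulant functional $\Psi_X(t,v)=\log\mathbb E[e^{\mathrm i\langle v,X(t)\rangle_{\mathsf F}}]$, $v\in\mathsf F$, is defined. A process $Z$ admits the limiting distribution $P_\infty$ if the law of $Z(t)$ converges weakly to the probability measure $P_\infty$ as $t\to\infty$. The process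 $Y$ is called cointegrated if there is a $\mathcal C\in L(\mathsf P,\mathsf C)$ such that $\mathcal CY(t)$ admits a limiting distribution. Then: 1. $Y$ is cointegrated if and only if there exist $\mathcal C\in L(\mathsf P,\mathsf C)$ and a cumulant function $\Psi_{\mathcal C}$ on $\mathsf C$ such that $$\lim_{t\to\infty}\Psi_X(t,\mathcal P^*\mathcal C^*u)=\Psi_{\mathcal C}(u)\quad\text{for all }u\in\mathsf C.\qquad(*)$$ 2. The same holds with non-degenerate operators only: there is a $\mathcal C\in L(\mathsf P,\mathsf C)$ with $\mathcal C\mathcal P\neq0$ such that $\mathcal CY(t)$ admits a limiting distribution whose characteristic function has no zeros, if and only if there are a $\mathcal C\in L(\mathsf P,\mathsf C)$ with $\mathcal C\mathcal P\ne0$ and a cumulant function $\Psi_{\mathcal C}$ on $\mathsf C$ such that $(*)$ holds. 3. Let $\mathcal C\in L(\mathsf P,\mathsf C)$ and let $P_\infty$ be a Borel probability measure on $\mathsf C$ whose characteristic function has no zeros. If $\mathcal CY(t)$ admits the limiting distribution $P_\infty$, then $(*)$ holds with $\Psi_{\mathcal C}$ the cumulant function of $P_\infty$. Conversely, if $\mathcal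 C$ has finite rank and $(*)$ holds with $\Psi_{\mathcal C}$ the cumulant function of $P_\infty$, then $\mathcal CY(t)$ admits the limiting distribution $P_\infty$. -/

import Mathlib

open MeasureTheory Filter
open scoped Topology NNReal

namespace HilbertCointegration

/-- `Ψ` is a distinguished logarithm of `φ : H → ℂ`: a continuous function with `Ψ 0 = 0` and
`exp (Ψ u) = φ u` for all `u`. -/
def IsDistinguishedLog {H : Type*} [TopologicalSpace H] [Zero H] (φ Ψ : H → ℂ) : Prop :=
  Continuous Ψ ∧ Ψ 0 = 0 ∧ ∀ u, Complex.exp (Ψ u) = φ u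

/-- A continuous zero-free function with value `1` at the origin of a real normed space has exactly
one distinguished logarithm. -/
theorem existsUnique_isDistinguishedLog {H : Type*} [NormedAddCommGroup H] [NormedSpace ℝ H]
    {φ : H → ℂ} (hφ : Continuous φ) (h0 : φ 0 = 1) (hne : ∀ u, φ u ≠ 0) :
    ∃! Ψ : H → ℂ, IsDistinguishedLog φ Ψ := by
  have key := Complex.isCoveringMap_exp.existsUnique_continuousMap_lifts
    (⟨fun u => (⟨φ u, hne u⟩ : {z : ℂ // z ≠ 0}), hφ.subtype_mk _⟩ : C(H, {z : ℂ // z ≠ 0}))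
    0 0 (by ext; simp [h0])
  obtain ⟨f, ⟨hf0, hf⟩, huniq⟩ := key
  refine ⟨f, ⟨f.continuous, hf0, fun u => congrArg Subtype.val (congrFun hf u)⟩, ?_⟩
  rintro Ψ ⟨hc, hΨ0, hΨ⟩
  have h := huniq ⟨Ψ, hc⟩ ⟨hΨ0, by funext u; exact Subtype.ext (hΨ u)⟩
  exact congrArg (fun g : C(H, ℂ) => (g : H → ℂ)) h

open Classical in
/-- The distinguished logarithm of `φ` (the zero function if `φ` has none). -/
noncomputable def distinguishedLog {H : Type*} [TopologicalSpace H] [Zero H] (φ : H → ℂ) :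
    H → ℂ :=
  if h : ∃ Ψ : H → ℂ, IsDistinguishedLog φ Ψ then h.choose else 0

section Measures

variable {H : Type*} [NormedAddCommGroup H] [InnerProductSpace ℝ H] [MeasurableSpace H]

/-- The characteristic function of `μ` has no zeros; this is exactly what is needed for the
distinguished logarithm of the characteristic function to exist. -/
def HasCumulant (μ : Measure H) : Prop := ∀ u : H, charFun μ u ≠ 0

/-- The cumulant function `u ↦ log ∫ exp (i ⟨u, x⟩) μ(dx)` of `μ`, `log` being the distinguished
logarithm. -/
noncomputable def cumulant (μ : Measure H) : H → ℂ := distinguishedLog (charFun μ)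

/-- `Ψ` is a cumulant function on `H`: the cumulant function of some Borel probability measure. -/
def IsCumulantFunction (Ψ : H → ℂ) : Prop :=
  ∃ μ : Measure H, IsProbabilityMeasure μ ∧ HasCumulant μ ∧ Ψ = cumulant μ

/-- The cumulant of a probability measure with zero-free characteristic function is indeed its
distinguished logarithm. -/
theorem isDistinguishedLog_cumulant [BorelSpace H] [SecondCountableTopology H] {μ : Measure H}
    [IsProbabilityMeasure μ] (h : HasCumulant μ) :
    IsDistinguishedLog (charFun μ) (cumulant μ) := by
  have hex : ∃ Ψ : H → ℂ, IsDistinguishedLog (charFun μ) Ψ :=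
    (existsUnique_isDistinguishedLog (by fun_prop) (by simp) h).exists
  unfold cumulant distinguishedLog
  rw [dif_pos hex]
  exact hex.choose_spec

end Measures

section Processes

variable {Ω : Type*} [MeasurableSpace Ω] (ℙ : Measure Ω) [IsProbabilityMeasure ℙ]
variable {H : Type*} [NormedAddCommGroup H] [InnerProductSpace ℝ H] [MeasurableSpace H]

/-- The cumulant functional `Ψ_X(t, v) = log 𝔼[exp (i ⟨v, X t⟩)]` of a process `X`. -/
noncomputable def cumulantFunctional (X : ℝ≥0 → Ω → H) (t : ℝ≥0) (v : H) : ℂ :=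
  cumulant (ℙ.map (X t)) v

/-- The laws of `Z t` converge to the probability measure `μ` as `t → ∞`, in the sense of weak
convergence of probability measures on `H`. -/
def HasLimitingDistribution [OpensMeasurableSpace H] (Z : ℝ≥0 → Ω → H)
    (μ : Measure H) [IsProbabilityMeasure μ] : Prop :=
  TendstoInDistribution Z atTop (id : H → H) (fun _ => ℙ) μ

/-- The process `Z` admits a limiting distribution. -/
def AdmitsLimitingDistribution [OpensMeasurableSpace H] (Z : ℝ≥0 → Ω → H) : Prop :=
  ∃ (μ : Measure H) (_ : IsProbabilityMeasure μ), HasLimitingDistribution ℙ Z μ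

/-- The price process `Y` is cointegrated with cointegration space `G`: for some bounded linear
operator `C` into `G`, the process `C Y` admits a limiting distribution. -/
def IsCointegrated (G : Type*) [NormedAddCommGroup G] [InnerProductSpace ℝ G]
    [MeasurableSpace G] [OpensMeasurableSpace G] (Y : ℝ≥0 → Ω → H) : Prop :=
  ∃ C : H →L[ℝ] G, AdmitsLimitingDistribution ℙ (fun t ω => C (Y t ω))

end Processes

end HilbertCointegration

namespace HilbertCointegration

open ContinuousLinearMap

/-! By uniqueness of the distinguished logarithm, `Ψ_X(t, P* C* u)` is the cumulant at `u` of the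
law of `C P X(t)` (`cumulantFunctional_adjoint`). Weak convergence makes characteristic functions
converge uniformly on the segment from `0` to `u`. If the limit is zero-free, their ratio to it
eventually stays near `1` there, so the difference of cumulants at `u` is the principal logarithm of
the ratio and tends to `0`. Conversely, exponentiating gives convergence of characteristic
functions. In infinite dimension this does not yield tightness, so Lévy's theorem applies only to
operators of finite rank. Since some operator suffices, `C` may be followed by the projection onto a
line that keeps `C P` nonzero. In the first equivalence, the zero process covers `C P = 0` and
limits without a cumulant. -/

theorem IsDistinguishedLog.unique {H : Type*} [NormedAddCommGroup H] [NormedSpace ℝ H]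
    {φ Ψ₁ Ψ₂ : H → ℂ} (h₁ : IsDistinguishedLog φ Ψ₁) (h₂ : IsDistinguishedLog φ Ψ₂) :
    Ψ₁ = Ψ₂ := by
  have hφ : φ = fun u => Complex.exp (Ψ₁ u) := funext fun u => (h₁.2.2 u).symm
  refine (existsUnique_isDistinguishedLog (φ := φ) ?_ ?_ ?_).unique h₁ h₂
  · rw [hφ]
    exact Complex.continuous_exp.comp h₁.1
  · rw [← h₁.2.2, h₁.2.1, Complex.exp_zero]
  · intro u
    rw [← h₁.2.2]
    exact Complex.exp_ne_zero _

/-- If `D` is continuous on the line, vanishes at `0`, and `exp ∘ D` stays in the unit disc around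
`1` over `[0, 1]`, then `D 1` is the principal logarithm of `exp (D 1)`. -/
theorem log_exp_eq_of_norm_exp_sub_one_lt {D : ℝ → ℂ} (hD : Continuous D) (h0 : D 0 = 0)
    (h : ∀ s ∈ Set.Icc (0 : ℝ) 1, ‖Complex.exp (D s) - 1‖ < 1) :
    Complex.log (Complex.exp (D 1)) = D 1 := by
  -- Clamping to `[0, 1]` extends the disc bound to the whole line, where uniqueness of the
  -- distinguished logarithm applies.
  let p : ℝ → ℝ := fun s => (Set.projIcc (0 : ℝ) 1 zero_le_one s : ℝ)
  have hp : Continuous p := continuous_subtype_val.comp continuous_projIcc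
  have hp0 : p 0 = 0 := by simp [p]
  have hp1 : p 1 = 1 := by simp [p]
  have hslit : ∀ s, Complex.exp (D (p s)) ∈ Complex.slitPlane := fun s => by
    refine Complex.ball_one_subset_slitPlane ?_
    rw [Metric.mem_ball, dist_eq_norm]
    exact h _ (Set.projIcc (0 : ℝ) 1 zero_le_one s).2
  have h₁ : IsDistinguishedLog (fun s => Complex.exp (D (p s))) (fun s => D (p s)) :=
    ⟨hD.comp hp, by simp only [hp0, h0], fun _ => rfl⟩
  have h₂ : IsDistinguishedLog (fun s => Complex.exp (D (p s)))
      (fun s => Complex.log (Complex.exp (D (p s)))) :=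
    ⟨(Complex.continuous_exp.comp (hD.comp hp)).clog hslit, by simp [hp0, h0],
      fun s => Complex.exp_log (Complex.exp_ne_zero _)⟩
  have := congrFun (h₂.unique h₁) 1
  simpa only [hp1] using this

theorem hasCumulant_dirac {H : Type*} [NormedAddCommGroup H] [InnerProductSpace ℝ H]
    [MeasurableSpace H] [OpensMeasurableSpace H] (x : H) : HasCumulant (Measure.dirac x) :=
  fun u => by
    rw [charFun_dirac]
    exact Complex.exp_ne_zero _

/-! ### Cumulants and bounded operators -/

section Operators

variable {H K : Type*} [NormedAddCommGroup H] [InnerProductSpace ℝ H] [CompleteSpace H]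
  [MeasurableSpace H] [BorelSpace H]
  [NormedAddCommGroup K] [InnerProductSpace ℝ K] [CompleteSpace K]
  [SecondCountableTopology K] [MeasurableSpace K] [BorelSpace K]

theorem charFun_map_clm (μ : Measure H) (L : H →L[ℝ] K) (u : K) :
    charFun (μ.map L) u = charFun μ (adjoint L u) := by
  rw [charFun_apply, charFun_apply, integral_map (by fun_prop) (by fun_prop)]
  simp only [adjoint_inner_right]

theorem HasCumulant.map {μ : Measure H} (h : HasCumulant μ) (L : H →L[ℝ] K) :
    HasCumulant (μ.map L) := fun u => by
  rw [charFun_map_clm]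
  exact h _

theorem hasCumulant_map_comp {Ω : Type*} [MeasurableSpace Ω] {ℙ : Measure Ω} {X : ℝ≥0 → Ω → H}
    (hX : ∀ t, Measurable (X t)) (hcum : ∀ t, HasCumulant (ℙ.map (X t))) (L : H →L[ℝ] K)
    (t : ℝ≥0) : HasCumulant (ℙ.map (fun ω => L (X t ω))) := by
  have := (hcum t).map L
  rwa [Measure.map_map (by fun_prop) (hX t)] at this

theorem cumulant_map [SecondCountableTopology H] {μ : Measure H} [IsProbabilityMeasure μ] (h : HasCumulant μ)
    (L : H →L[ℝ] K) (u : K) : cumulant (μ.map L) u = cumulant μ (adjoint L u) := by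
  have : IsProbabilityMeasure (μ.map L) := Measure.isProbabilityMeasure_map (by fun_prop)
  have hμ := isDistinguishedLog_cumulant h
  have h' : IsDistinguishedLog (charFun (μ.map L)) (fun u => cumulant μ (adjoint L u)) :=
    ⟨hμ.1.comp (adjoint L).continuous, by simp only [map_zero, hμ.2.1], fun u => by
      rw [hμ.2.2, charFun_map_clm]⟩
  exact congrFun ((isDistinguishedLog_cumulant (h.map L)).unique h') u

end Operators

theorem hasLimitingDistribution_zero {Ω : Type*} [MeasurableSpace Ω] {ℙ : Measure Ω}
    [IsProbabilityMeasure ℙ] {H : Type*} [NormedAddCommGroup H] [MeasurableSpace H]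
    [BorelSpace H] : HasLimitingDistribution ℙ (fun _ _ => (0 : H)) (Measure.dirac 0) :=
  tendstoInDistribution_of_identDistrib 0 (fun _ => .refl (by fun_prop))
    ⟨by fun_prop, by fun_prop, by simp⟩

/-! ### Weak convergence, characteristic functions and cumulants -/

section Convergence

variable {Ω : Type*} [MeasurableSpace Ω] {ℙ : Measure Ω} [IsProbabilityMeasure ℙ]
  {H : Type*} [NormedAddCommGroup H] [InnerProductSpace ℝ H]
  [MeasurableSpace H] [BorelSpace H]
  {Z : ℝ≥0 → Ω → H} {μ : Measure H} [IsProbabilityMeasure μ]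

theorem tendsto_charFun_of_tendstoInDistribution {ι : Type*} {l : Filter ι} {W : ι → Ω → H}
    {Ω' : Type*} [MeasurableSpace Ω'] {ℙ' : Measure Ω'} [IsProbabilityMeasure ℙ'] {V : Ω' → H}
    (h : TendstoInDistribution W l V (fun _ => ℙ) ℙ') (u : H) :
    Tendsto (fun i => charFun (ℙ.map (W i)) u) l (𝓝 (charFun (ℙ'.map V) u)) := by
  have h' := (ProbabilityMeasure.tendsto_iff_forall_integral_rclike_tendsto ℂ).1 h.tendsto
    (BoundedContinuousFunction.innerProbChar u)
  simpa only [charFun_eq_integral_innerProbChar] using! h'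

variable [SecondCountableTopology H]

/-- Under convergence in law the characteristic functions converge continuously along rays. -/
theorem HasLimitingDistribution.tendsto_charFun_smul (h : HasLimitingDistribution ℙ Z μ)
    (u : H) (s : ℝ) :
    Tendsto (fun p : ℝ≥0 × ℝ => charFun (ℙ.map (Z p.1)) (p.2 • u)) (atTop ×ˢ 𝓝 s)
      (𝓝 (charFun μ (s • u))) := by
  have hZ : TendstoInDistribution (fun p : ℝ≥0 × ℝ => Z p.1) (atTop ×ˢ 𝓝 s) (id : H → H)
      (fun _ => ℙ) μ :=
    ⟨fun p => h.forall_aemeasurable p.1, h.aemeasurable_limit, h.tendsto.comp tendsto_fst⟩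
  -- The scalars, as random variables constant in `ω`, converge in measure to `s`; Slutsky's theorem
  -- then handles the product with `Z`.
  have hs : TendstoInMeasure ℙ (fun (p : ℝ≥0 × ℝ) (_ : Ω) => p.2) (atTop ×ˢ 𝓝 s)
      (fun _ => s) := by
    intro ε hε
    refine tendsto_const_nhds.congr' ?_
    have hball : ∀ᶠ p : ℝ≥0 × ℝ in atTop ×ˢ 𝓝 s, edist p.2 s < ε :=
      tendsto_snd.eventually (Metric.eball_mem_nhds s hε)
    filter_upwards [hball] with p hp
    simp [not_le.2 hp]
  have := tendsto_charFun_of_tendstoInDistribution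
    (hZ.continuous_comp_prodMk_of_tendstoInMeasure_const
      (g := fun q : H × ℝ => q.2 • q.1) (by fun_prop) hs (fun _ => by fun_prop)) u
  refine (this.congr fun p => ?_).trans_eq ?_
  · exact charFun_map_smul_comp (h.forall_aemeasurable p.1) p.2 u
  · exact congrArg 𝓝 ((charFun_map_smul s u).trans rfl)

/-- Convergence in law of zero-free laws to a zero-free law gives pointwise convergence of the
cumulants. -/
theorem HasLimitingDistribution.tendsto_cumulant (h : HasLimitingDistribution ℙ Z μ)
    (hμ : HasCumulant μ) (hZ : ∀ t, HasCumulant (ℙ.map (Z t))) (u : H) :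
    Tendsto (fun t => cumulant (ℙ.map (Z t)) u) atTop (𝓝 (cumulant μ u)) := by
  have hprob : ∀ t, IsProbabilityMeasure (ℙ.map (Z t)) := fun t =>
    Measure.isProbabilityMeasure_map (h.forall_aemeasurable t)
  have hlog := isDistinguishedLog_cumulant hμ
  have hlogZ := fun t => isDistinguishedLog_cumulant (hZ t)
  let D : ℝ≥0 → ℝ → ℂ := fun t s => cumulant (ℙ.map (Z t)) (s • u) - cumulant μ (s • u)
  have hDc : ∀ t, Continuous (D t) := fun t =>
    ((hlogZ t).1.comp (by fun_prop)).sub (hlog.1.comp (by fun_prop))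
  have hD0 : ∀ t, D t 0 = 0 := fun t => by simp [D, hlog.2.1, (hlogZ t).2.1]
  have hexp : ∀ s : ℝ, Tendsto (fun p : ℝ≥0 × ℝ => Complex.exp (D p.1 p.2)) (atTop ×ˢ 𝓝 s)
      (𝓝 1) := fun s => by
    have hden : Tendsto (fun p : ℝ≥0 × ℝ => charFun μ (p.2 • u)) (atTop ×ˢ 𝓝 s)
        (𝓝 (charFun μ (s • u))) := by
      have hc : Continuous fun r : ℝ => charFun μ (r • u) := by fun_prop
      exact (hc.tendsto s).comp tendsto_snd
    have := (h.tendsto_charFun_smul u s).div hden (hμ _)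
    rw [div_self (hμ _)] at this
    refine this.congr fun p => ?_
    simp only [D, Complex.exp_sub, hlog.2.2, (hlogZ _).2.2, Pi.div_apply]
  -- Joint convergence near each `s` and compactness of `[0, 1]` give one threshold in `t` valid for
  -- all `s`.
  have hlt : ∀ᶠ t in atTop, ∀ s ∈ Set.Icc (0 : ℝ) 1, ‖Complex.exp (D t s) - 1‖ < 1 := by
    have hmem : {p : ℝ≥0 × ℝ | ‖Complex.exp (D p.1 p.2) - 1‖ < 1} ∈
        (atTop : Filter ℝ≥0) ×ˢ 𝓝ˢ (Set.Icc (0 : ℝ) 1) := by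
      refine isCompact_Icc.mem_prod_nhdsSet_of_forall fun s _ => ?_
      filter_upwards [(hexp s).eventually (Metric.ball_mem_nhds 1 one_pos)] with p hp
      simpa [dist_eq_norm] using hp
    obtain ⟨A, hA, B, hB, hAB⟩ := mem_prod_iff.1 hmem
    filter_upwards [hA] with t ht s hs
    exact hAB (Set.mk_mem_prod ht (subset_of_mem_nhdsSet hB hs))
  have hone : Tendsto (fun t => Complex.log (Complex.exp (D t 1))) atTop (𝓝 0) := by
    have h1 : Tendsto (fun t : ℝ≥0 => (t, (1 : ℝ))) atTop (atTop ×ˢ 𝓝 1) :=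
      tendsto_id.prodMk tendsto_const_nhds
    have := ((hexp 1).comp h1).clog (by simp)
    simpa using this
  have hD1 : Tendsto (fun t => D t 1) atTop (𝓝 0) := by
    refine hone.congr' ?_
    filter_upwards [hlt] with t ht
    exact log_exp_eq_of_norm_exp_sub_one_lt (hDc t) (hD0 t) ht
  have := hD1.add_const (cumulant μ u)
  simpa [D] using this

/-- **Lévy's continuity theorem** along `t → ∞` for processes with values in a fixed
finite-dimensional subspace of a Hilbert space. -/
theorem hasLimitingDistribution_of_tendsto_charFun [CompleteSpace H] (V : Submodule ℝ H)
    [FiniteDimensional ℝ V] (hZm : ∀ t, Measurable (Z t)) (hZV : ∀ t ω, Z t ω ∈ V)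
    (h : ∀ u, Tendsto (fun t => charFun (ℙ.map (Z t)) u) atTop (𝓝 (charFun μ u))) :
    HasLimitingDistribution ℙ Z μ := by
  have hVs : SecondCountableTopology V := inferInstance
  let p : H →L[ℝ] V := V.orthogonalProjectionOnto
  have hZp : ∀ t, V.subtypeL ∘ (fun ω => p (Z t ω)) = Z t := fun t => by
    funext ω
    simp [p, Submodule.starProjection_eq_self_iff.2 (hZV t ω)]
  have hpZ : ∀ t, (ℙ.map (Z t)).map p = ℙ.map (fun ω => p (Z t ω)) := fun t =>
    Measure.map_map (by fun_prop) (hZm t)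
  have hmp : ∀ t, Measurable fun ω => p (Z t ω) := fun t => p.measurable.comp (hZm t)
  have hsub : ∀ t, (ℙ.map (fun ω => p (Z t ω))).map V.subtypeL = ℙ.map (Z t) := fun t => by
    rw [Measure.map_map (by fun_prop) (hmp t), hZp]
  have : IsProbabilityMeasure (μ.map p) := Measure.isProbabilityMeasure_map (by fun_prop)
  have : IsProbabilityMeasure ((μ.map p).map V.subtypeL) :=
    Measure.isProbabilityMeasure_map (by fun_prop)
  have hlim : ∀ v : V, Tendsto (fun t => charFun (ℙ.map (fun ω => p (Z t ω))) v) atTop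
      (𝓝 (charFun (μ.map p) v)) := fun v => by
    simp only [← hpZ, charFun_map_clm]
    exact h _
  -- That `μ` is carried by `V` is not assumed: it follows from uniqueness of limits of
  -- characteristic functions.
  have hμ : (μ.map p).map V.subtypeL = μ := by
    refine Measure.ext_of_charFun (funext fun u => ?_)
    have h₁ := hlim (adjoint V.subtypeL u)
    simp only [← charFun_map_clm, hsub] at h₁
    exact tendsto_nhds_unique h₁ (h u)
  have hV : TendstoInDistribution (fun t ω => p (Z t ω)) atTop p (fun _ => ℙ) μ := by
    refine ⟨fun t => (hmp t).aemeasurable, by fun_prop, ?_⟩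
    -- Lévy's theorem is used along sequences, which suffice because `atTop` on `ℝ≥0` is countably
    -- generated.
    refine tendsto_of_seq_tendsto fun x hx => ?_
    exact ProbabilityMeasure.tendsto_of_tendsto_charFun fun v => (hlim v).comp hx
  have hH := hV.continuous_comp V.subtypeL.continuous
  simp only [hZp] at hH
  refine ⟨hH.forall_aemeasurable, aemeasurable_id, ?_⟩
  have hlaw : μ.map (V.subtypeL ∘ p) = μ.map id := by
    rw [← Measure.map_map (by fun_prop) (by fun_prop), hμ, Measure.map_id]
  have ht := hH.tendsto
  convert! ht using 3
  exact congrArg 𝓝 (Subtype.ext hlaw.symm)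

end Convergence

/-! ### Cumulant functional and limits of the transformed process -/

section Cointegration

variable {Ω : Type*} [MeasurableSpace Ω] {ℙ : Measure Ω} [IsProbabilityMeasure ℙ]
  {F : Type*} [NormedAddCommGroup F] [InnerProductSpace ℝ F] [CompleteSpace F]
  [SecondCountableTopology F] [MeasurableSpace F] [BorelSpace F]
  {G : Type*} [NormedAddCommGroup G] [InnerProductSpace ℝ G] [CompleteSpace G]
  [SecondCountableTopology G] [MeasurableSpace G] [BorelSpace G]
  {X : ℝ≥0 → Ω → F} {μ : Measure G} [IsProbabilityMeasure μ]

theorem cumulantFunctional_adjoint (hX : ∀ t, Measurable (X t))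
    (hcum : ∀ t, HasCumulant (ℙ.map (X t))) (L : F →L[ℝ] G) (t : ℝ≥0) (u : G) :
    cumulantFunctional ℙ X t (adjoint L u) = cumulant (ℙ.map (fun ω => L (X t ω))) u := by
  have := Measure.isProbabilityMeasure_map (μ := ℙ) (hX t).aemeasurable
  rw [cumulantFunctional, ← cumulant_map (hcum t), Measure.map_map (by fun_prop) (hX t)]
  rfl

theorem tendsto_cumulantFunctional_of_hasLimitingDistribution (hX : ∀ t, Measurable (X t))
    (hcum : ∀ t, HasCumulant (ℙ.map (X t))) (L : F →L[ℝ] G) (hμ : HasCumulant μ)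
    (h : HasLimitingDistribution ℙ (fun t ω => L (X t ω)) μ) (u : G) :
    Tendsto (fun t => cumulantFunctional ℙ X t (adjoint L u)) atTop (𝓝 (cumulant μ u)) := by
  simp only [cumulantFunctional_adjoint hX hcum]
  exact h.tendsto_cumulant hμ (hasCumulant_map_comp hX hcum L) u

theorem hasLimitingDistribution_of_tendsto_cumulantFunctional (hX : ∀ t, Measurable (X t))
    (hcum : ∀ t, HasCumulant (ℙ.map (X t))) (L : F →L[ℝ] G) (V : Submodule ℝ G)
    [FiniteDimensional ℝ V] (hL : ∀ x, L x ∈ V) (hμ : HasCumulant μ)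
    (h : ∀ u, Tendsto (fun t => cumulantFunctional ℙ X t (adjoint L u)) atTop
      (𝓝 (cumulant μ u))) :
    HasLimitingDistribution ℙ (fun t ω => L (X t ω)) μ := by
  have hm : ∀ t, Measurable fun ω => L (X t ω) := fun t => L.measurable.comp (hX t)
  have := fun t => Measure.isProbabilityMeasure_map (μ := ℙ) (hm t).aemeasurable
  refine hasLimitingDistribution_of_tendsto_charFun V hm (fun t ω => hL _) fun u => ?_
  have h' := (Complex.continuous_exp.tendsto _).comp (h u)
  rw [(isDistinguishedLog_cumulant hμ).2.2] at h'
  refine h'.congr fun t => ?_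
  rw [Function.comp_apply, cumulantFunctional_adjoint hX hcum,
    (isDistinguishedLog_cumulant (hasCumulant_map_comp hX hcum L t)).2.2]

/-- Convergence of the cumulants for `L` gives convergence in law after projecting onto any
finite-dimensional subspace. -/
theorem hasLimitingDistribution_starProjection (hX : ∀ t, Measurable (X t))
    (hcum : ∀ t, HasCumulant (ℙ.map (X t))) (L : F →L[ℝ] G) (V : Submodule ℝ G)
    [FiniteDimensional ℝ V] (hμ : HasCumulant μ)
    (h : ∀ u, Tendsto (fun t => cumulantFunctional ℙ X t (adjoint L u)) atTop
      (𝓝 (cumulant μ u))) [IsProbabilityMeasure (μ.map V.starProjection)] :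
    HasLimitingDistribution ℙ (fun t ω => V.starProjection (L (X t ω)))
      (μ.map V.starProjection) := by
  refine hasLimitingDistribution_of_tendsto_cumulantFunctional hX hcum (V.starProjection ∘L L) V
    (fun x => Submodule.starProjection_apply_mem V (L x)) (hμ.map _) fun u => ?_
  -- What remains is the hypothesis `h` at the image of `u` under the adjoint projection.
  rw [cumulant_map hμ]
  simpa only [adjoint_comp, comp_apply] using h _

end Cointegration

end HilbertCointegration

open HilbertCointegration ContinuousLinearMap in
theorem proposition4p2
    {Ω : Type*} [MeasurableSpace Ω] (ℙ : Measure Ω) [IsProbabilityMeasure ℙ]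
    -- the factor space, the price space and the cointegration space
    {F : Type*} [NormedAddCommGroup F] [InnerProductSpace ℝ F] [CompleteSpace F]
    [TopologicalSpace.SeparableSpace F] [MeasurableSpace F] [BorelSpace F]
    {Pr : Type*} [NormedAddCommGroup Pr] [InnerProductSpace ℝ Pr] [CompleteSpace Pr]
    [TopologicalSpace.SeparableSpace Pr] [MeasurableSpace Pr] [BorelSpace Pr]
    {G : Type*} [NormedAddCommGroup G] [InnerProductSpace ℝ G] [CompleteSpace G]
    [TopologicalSpace.SeparableSpace G] [MeasurableSpace G] [BorelSpace G]
    (P : F →L[ℝ] Pr) (X : ℝ≥0 → Ω → F) (hX : ∀ t, Measurable (X t))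
    -- the cumulant functional of `X` is defined
    (hcum : ∀ t, HasCumulant (ℙ.map (X t))) :
    -- the equivalence
    (IsCointegrated ℙ G (fun t ω => P (X t ω)) ↔
      ∃ (C : Pr →L[ℝ] G) (Ψ : G → ℂ), IsCumulantFunction Ψ ∧
        ∀ u : G, Tendsto (fun t => cumulantFunctional ℙ X t (adjoint P (adjoint C u)))
          atTop (𝓝 (Ψ u))) ∧
    -- the equivalence with non-degenerate cointegration operators only
    ((∃ C : Pr →L[ℝ] G, C ∘L P ≠ 0 ∧ ∃ (μ : Measure G) (_ : IsProbabilityMeasure μ),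
        HasCumulant μ ∧ HasLimitingDistribution ℙ (fun t ω => C (P (X t ω))) μ) ↔
      ∃ C : Pr →L[ℝ] G, C ∘L P ≠ 0 ∧ ∃ Ψ : G → ℂ, IsCumulantFunction Ψ ∧
        ∀ u : G, Tendsto (fun t => cumulantFunctional ℙ X t (adjoint P (adjoint C u)))
          atTop (𝓝 (Ψ u))) ∧
    -- for one and the same operator and limit law: convergence in law gives convergence of the
    -- cumulants, and conversely if the operator has finite rank
    (∀ (C : Pr →L[ℝ] G) (μ : Measure G) [IsProbabilityMeasure μ], HasCumulant μ →
      (HasLimitingDistribution ℙ (fun t ω => C (P (X t ω))) μ →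
        ∀ u : G, Tendsto (fun t => cumulantFunctional ℙ X t (adjoint P (adjoint C u)))
          atTop (𝓝 (cumulant μ u))) ∧
      (FiniteDimensional ℝ (LinearMap.range (C : Pr →ₗ[ℝ] G)) →
        (∀ u : G, Tendsto (fun t => cumulantFunctional ℙ X t (adjoint P (adjoint C u)))
          atTop (𝓝 (cumulant μ u))) →
        HasLimitingDistribution ℙ (fun t ω => C (P (X t ω))) μ)) := by
  have : SecondCountableTopology F := UniformSpace.secondCountable_of_separable F
  have : SecondCountableTopology Pr := UniformSpace.secondCountable_of_separable Pr
  have : SecondCountableTopology G := UniformSpace.secondCountable_of_separable G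
  have hadj : ∀ (C : Pr →L[ℝ] G) (u : G), adjoint P (adjoint C u) = adjoint (C ∘L P) u :=
    fun C u => by rw [adjoint_comp, comp_apply]
  simp only [hadj]
  have forward : ∀ (C : Pr →L[ℝ] G) (μ : Measure G) [IsProbabilityMeasure μ], HasCumulant μ →
      HasLimitingDistribution ℙ (fun t ω => C (P (X t ω))) μ → ∀ u : G,
        Tendsto (fun t => cumulantFunctional ℙ X t (adjoint (C ∘L P) u)) atTop
          (𝓝 (cumulant μ u)) := fun C μ _ hμ h =>
    tendsto_cumulantFunctional_of_hasLimitingDistribution hX hcum (C ∘L P) hμ h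
  have nondegenerate : ∀ (C : Pr →L[ℝ] G), C ∘L P ≠ 0 → ∀ Ψ : G → ℂ, IsCumulantFunction Ψ →
      (∀ u : G, Tendsto (fun t => cumulantFunctional ℙ X t (adjoint (C ∘L P) u)) atTop
        (𝓝 (Ψ u))) →
      ∃ C' : Pr →L[ℝ] G, C' ∘L P ≠ 0 ∧ ∃ (μ : Measure G) (_ : IsProbabilityMeasure μ),
        HasCumulant μ ∧ HasLimitingDistribution ℙ (fun t ω => C' (P (X t ω))) μ := by
    rintro C hC _ ⟨μ, _, hμ, rfl⟩ h
    obtain ⟨x, hx⟩ : ∃ x, (C ∘L P) x ≠ 0 := by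
      by_contra! hzero
      exact hC (ContinuousLinearMap.ext hzero)
    -- The projection onto this line fixes the nonzero vector `C P x`, so the new operator has rank
    -- at most one and is still nonzero after `P`.
    let V : Submodule ℝ G := Submodule.span ℝ {(C ∘L P) x}
    have hprob : IsProbabilityMeasure (μ.map V.starProjection) :=
      Measure.isProbabilityMeasure_map (by fun_prop)
    refine ⟨V.starProjection ∘L C, fun hzero => hx ?_, μ.map V.starProjection, hprob,
      hμ.map _, hasLimitingDistribution_starProjection hX hcum (C ∘L P) V hμ h⟩
    have hmem : (C ∘L P) x ∈ V := Submodule.mem_span_singleton_self _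
    rw [← Submodule.starProjection_eq_self_iff.2 hmem]
    exact DFunLike.congr_fun hzero x
  refine ⟨⟨?_, ?_⟩, ⟨?_, ?_⟩, fun C μ _ hμ => ⟨forward C μ hμ, fun hfin h => ?_⟩⟩
  · rintro ⟨C, μ, _, h⟩
    by_cases hμ : HasCumulant μ
    · exact ⟨C, cumulant μ, ⟨μ, inferInstance, hμ, rfl⟩, forward C μ hμ h⟩
    · -- a limit law whose characteristic function vanishes somewhere has no cumulant
      exact ⟨0, _, ⟨_, inferInstance, hasCumulant_dirac 0, rfl⟩,
        forward 0 _ (hasCumulant_dirac 0) hasLimitingDistribution_zero⟩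
  · rintro ⟨C, Ψ, hΨ, h⟩
    by_cases hC : C ∘L P = 0
    · refine ⟨C, Measure.dirac 0, inferInstance, ?_⟩
      have hzero : (fun (t : ℝ≥0) ω => C (P (X t ω))) = fun _ _ => 0 :=
        funext₂ fun t ω => DFunLike.congr_fun hC (X t ω)
      rw [hzero]
      exact hasLimitingDistribution_zero
    · obtain ⟨C', -, μ, hprob, -, hlim⟩ := nondegenerate C hC Ψ hΨ h
      exact ⟨C', μ, hprob, hlim⟩
  · rintro ⟨C, hC, μ, _, hμ, h⟩
    exact ⟨C, hC, cumulant μ, ⟨μ, inferInstance, hμ, rfl⟩, forward C μ hμ h⟩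
  · rintro ⟨C, hC, Ψ, hΨ, h⟩
    exact nondegenerate C hC Ψ hΨ h
  · exact hasLimitingDistribution_of_tendsto_cumulantFunctional hX hcum (C ∘L P)
      (LinearMap.range (C : Pr →ₗ[ℝ] G)) (fun x => ⟨P x, rfl⟩) hμ h
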